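/- **Theorem 2.3 (Linear ill-posedness).** Let $\Omega,\beta,\eta>0$ and put $\mu=\beta^2/\eta$. On the torus $\mathbb T^3=[0,2\pi]^3$ (functions $2\pi$-periodic in each variable) let $M_3$ be the Fourier multiplier operator with symbol $$\widehat M_3(k)=\frac{\mu\,k_2^2\,(k_1^2+k_2^2)}{4\Omega^2k_3^2|k|^2+\mu^2k_2^4}\quad(k\in\mathbb Z^3,\ k_3\neq0),\qquad \widehat M_3(k)=0\quad(k_3=0).$$ Let $a>0$ be real, let $m\ge1$ be an integer, let $\Theta_0(x)=a\sin(mx_3)$, and let $$L\theta=-M_3\theta\;\partial_3\Theta_0 .$$ For $s\in\mathbb R$ and $1\le p\le\infty$ let $W^{s,p}$ be the Sobolev space on $\mathbb T^3$ with norm $\|f\|_{W^{s,p}}=\|(1-\Delta)^{s/2}f\|_{L^p}$ (so $W^{s,2}=H^s$). Then the Cauchy problem for $\partial_t\theta=L\theta$ is ill-posed over $L^2$ in the following sense. For every $T>0$ and every $K>0$ there is a real-valued, real-analytic, periodic initial datum $\theta_0$ with zero vertical mean ($\int_0^{2\pi}\theta_0\,dx_3=0$ for all $x_1,x_2$) such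 that, for every Sobolev space $Y=W^{s,p}$ that is continuously embedded in $L^2$, there is no $\theta\in L^\infty(0,T;L^2(\mathbb T^3))$ that solves $\partial_t\theta=L\theta$, $\theta(0)=\theta_0$ and satisfies $$\operatorname*{ess\,sup}_{t\in(0,T)}\|\theta(t)\|_{L^2}\le K\,\|\theta_0\|_{Y}.$$ Here a solution is a real-valued $\theta\in L^\infty(0,T;L^2)$ such that, for every smooth $\varphi:\mathbb R\times\mathbb T^3\to\mathbb C$ that vanishes for all $t\ge S$, for some $S<T$, $$\int_0^T\Big(\int_{\mathbb T^3}\theta\,\partial_t\varphi\,dx+\langle L\theta,\varphi\rangle\Big)dt+\int_{\mathbb T^3}\theta_0\,\varphi(0,\cdot)\,dx=0,$$ where $\langle L\theta,\varphi\rangle=-\langle M_3\theta,\varphi\,\partial_3\Theta_0\rangle$ is the bilinear pairing of the distribution $M_3\theta$, which has the Fourier coefficients $\widehat M_3(k)\widehat\theta(k)$, with the smooth function $\varphi\,\partial_3\Theta_0$. -/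

import Mathlib

open MeasureTheory
open scoped ENNReal NNReal ContDiff

noncomputable section

namespace MG

/-- The space `ℝ³`. Functions on the torus `𝕋³ = [0,2π]³` are represented by functions on `ℝ³` that
are `2π`-periodic in each coordinate, or by their classes on the cell `[0,2π]³`.
The coordinates `x₁, x₂, x₃` are `x 0, x 1, x 2`. -/
abbrev Space : Type := Fin 3 → ℝ

/-- The periodicity cell `[0,2π]³`. -/
def cell : Set Space := Set.Icc 0 (fun _ => 2 * Real.pi)

/-- Lebesgue measure on the cell `[0,2π]³`. -/
def cellMeasure : Measure Space := volume.restrict cell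

/-- `2π`-periodicity in each of the three coordinates. -/
def IsPeriodic {α : Type} (f : Space → α) : Prop :=
  ∀ (x : Space) (i : Fin 3), f (x + Pi.single i (2 * Real.pi)) = f x

/-- Zero vertical mean: `∫₀^{2π} f(x₁,x₂,z) dz = 0` for all `x₁, x₂`. -/
def HasZeroVerticalMean (f : Space → ℝ) : Prop :=
  ∀ x : Space, ∫ z in (0 : ℝ)..(2 * Real.pi), f (Function.update x 2 z) = 0

/-- The plane wave `x ↦ exp(i k·x)`. -/
def wave (k : Fin 3 → ℤ) (x : Space) : ℂ :=
  Complex.exp (Complex.I * ∑ i, (k i : ℂ) * (x i : ℂ))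

/-- The Fourier coefficient `(2π)⁻³ ∫_{[0,2π]³} f(x) exp(-i k·x) dx`. -/
def fourierCoef (f : Space → ℂ) (k : Fin 3 → ℤ) : ℂ :=
  ((2 * Real.pi : ℝ) : ℂ)⁻¹ ^ 3 * ∫ x, f x * wave (-k) x ∂cellMeasure

/-- `|k|² = k₁² + k₂² + k₃²`. -/
def normSq (k : Fin 3 → ℤ) : ℝ := ∑ i, (k i : ℝ) ^ 2

/-- The symbol of the operator `M₃`; it is `0` on `{k₃ = 0}`. -/
def symbolM3 (Ω β η : ℝ) (k : Fin 3 → ℤ) : ℝ :=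
  if k 2 = 0 then 0
  else (β ^ 2 / η) * (k 1 : ℝ) ^ 2 * ((k 0 : ℝ) ^ 2 + (k 1 : ℝ) ^ 2) /
    (4 * Ω ^ 2 * (k 2 : ℝ) ^ 2 * normSq k + (β ^ 2 / η) ^ 2 * (k 1 : ℝ) ^ 4)

/-- The pairing `⟨M₃ f, ψ⟩` of the distribution `M₃ f` on the torus, `f ∈ L²`, whose Fourier
coefficients are `symbolM3 k * fourierCoef f k`, with a smooth periodic function `ψ`. It extends the
bilinear pairing `∫ (M₃ f) ψ dx`. -/
def pairM3 (Ω β η : ℝ) (f ψ : Space → ℂ) : ℂ :=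
  ((2 * Real.pi : ℝ) : ℂ) ^ 3 *
    ∑' k : Fin 3 → ℤ, (symbolM3 Ω β η k : ℂ) * fourierCoef f k * fourierCoef ψ (-k)

/-- The steady state `Θ₀(x) = a sin(m x₃)`. -/
def steadyState (a : ℝ) (m : ℕ) (x : Space) : ℝ := a * Real.sin (m * x 2)

/-- The vertical derivative `∂₃`. -/
def vertDeriv (f : Space → ℝ) (x : Space) : ℝ := lineDeriv ℝ f x (Pi.single 2 1)

/-- The pairing `⟨L f, φ⟩` of the distribution `L f = - M₃ f · ∂₃Θ₀`, `f ∈ L²`, with a smooth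
periodic function `φ`. -/
def pairL (Ω β η a : ℝ) (m : ℕ) (f φ : Space → ℂ) : ℂ :=
  - pairM3 Ω β η f (fun x => (vertDeriv (steadyState a m) x : ℂ) * φ x)

/-- Test functions on `[0,T) × 𝕋³`: smooth, periodic in space, vanishing for times near `T` and
after. They need not vanish at time `0`. -/
def IsTestFunction (T : ℝ) (φ : ℝ → Space → ℂ) : Prop :=
  ContDiff ℝ ∞ (fun q : ℝ × Space => φ q.1 q.2) ∧
  (∀ t, IsPeriodic (φ t)) ∧
  ∃ S < T, ∀ t, S ≤ t → ∀ x, φ t x = 0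

/-- `θ ∈ L^∞(0,T;L²(𝕋³))` is a (distributional) solution of the Cauchy problem `∂ₜθ = Lθ`,
`θ(0) = θ₀`, on `(0,T) × 𝕋³`. -/
def IsSolution (Ω β η a : ℝ) (m : ℕ) (T : ℝ) (θ₀ : Space → ℝ)
    (θ : ℝ → Lp ℝ 2 cellMeasure) : Prop :=
  MemLp θ ∞ (volume.restrict (Set.Ioo 0 T)) ∧
  ∀ φ : ℝ → Space → ℂ, IsTestFunction T φ →
    (∫ t in Set.Ioo 0 T,
        ((∫ x, ((θ t : Space → ℝ) x : ℂ) * deriv (fun r => φ r x) t ∂cellMeasure) +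
          pairL Ω β η a m (fun x => ((θ t : Space → ℝ) x : ℂ)) (φ t))) +
      ∫ x, (θ₀ x : ℂ) * φ 0 x ∂cellMeasure = 0

/-- The norm `‖(1-Δ)^{s/2} f‖_{L^p}` of the Sobolev space `W^{s,p}(𝕋³)`; it is `∞` when `f` is not in
that space. The function `g = (1-Δ)^{s/2} f` is determined almost everywhere by its Fourier
coefficients, so the infimum is over at most one class. For `p = 2` this is the norm of `H^s`. -/
def sobolevNorm (s : ℝ) (p : ℝ≥0∞) (f : Space → ℂ) : ℝ≥0∞ :=
  ⨅ (g : Space → ℂ) (_ : MemLp g p cellMeasure ∧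
      ∀ k, fourierCoef g k = (((1 + normSq k) ^ (s / 2) : ℝ) : ℂ) * fourierCoef f k),
    eLpNorm g p cellMeasure

/-- The Sobolev space `W^{s,p}(𝕋³)` is continuously embedded in `L²(𝕋³)`. -/
def EmbedsInL2 (s : ℝ) (p : ℝ≥0∞) : Prop :=
  ∃ C : ℝ≥0, ∀ f : Space → ℂ, Integrable f cellMeasure →
    eLpNorm f 2 cellMeasure ≤ C * sobolevNorm s p f

end MG

end

/-!
The datum is chosen so that the Cauchy problem has no solution in `L^∞(0,T;L²)` at all, with or
without a bound by `K ‖θ₀‖_Y`: the growth of the Fourier modes outruns the decay of the Fourier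
coefficients of a real-analytic function whose radius of analyticity is small compared to `T`.

Multiplication by `∂₃Θ₀ = a m cos (m x₃)` only shifts the vertical frequency by `± m`, so for each
horizontal frequency `(k₁, k₂)` the equation is an infinite chain of scalar ODEs for the
coefficients at `(k₁, k₂, j m)` (`IsSolution.weak_mode`, `ae_eq_primitive_of_weak`). After
multiplication by `(-1) ^ j` the coupling coefficients `a m M₃ / 2` are nonnegative. Since `M₃`
vanishes at `j = 0`, the components `j ≥ 1` form a closed chain. For `k₂ ≠ 0` the coupling is
bounded, so a comparison principle holds (`chain_nonneg`), and an explicit subsolution supported on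
`j = 1, 2` shows growth like `exp (γ t)`, where `γ` bounds the coupling at `j = 1, 2` from below
(`chain_growth`).

On the parabola `(k₁, k₂) = (n², n)` the symbol is at least `c n²` at `j = 1, 2`
(`le_symbolM3_mode`), hence `γ = κ n²` with `κ > 0` independent of `n`. The datum is a product of
Poisson kernels in `x₁` and `x₂` with a vertical profile `cos (2 m x₃) - cos (m x₃)`, which has the
right signs; its coefficients on the parabola are `± r ^ (n² + n) / 2`. With `r = exp (-κ T / 8)` the
coefficient at `j = 1` and a time `t > T / 2` is at least `exp (κ T n² / 4) / 2`, which is unbounded in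
`n`, whereas the Fourier coefficients of `θ(t)` are bounded by a multiple of `‖θ(t)‖_{L²}`.
-/

noncomputable section
namespace MG

/-! ### Plane waves and Fourier coefficients on the torus -/

/-- The Fourier coefficient `(2π)⁻¹ ∫₀^{2π} F(x) exp(-i n x) dx` of a function of one variable. -/
def circleCoef (F : ℝ → ℂ) (n : ℤ) : ℂ :=
  ((2 * Real.pi : ℝ) : ℂ)⁻¹ *
    ∫ x in (0 : ℝ)..(2 * Real.pi), F x * Complex.exp (Complex.I * ((-n : ℤ) * x))

lemma cellMeasure_eq_pi :
    cellMeasure = Measure.pi (fun _ => volume.restrict (Set.Icc 0 (2 * Real.pi))) := by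
  rw [cellMeasure, cell, volume_pi, ← Set.pi_univ_Icc, Measure.restrict_pi_pi]
  rfl

instance : IsFiniteMeasure cellMeasure := by
  rw [cellMeasure_eq_pi]; infer_instance

lemma wave_eq_prod (k : Fin 3 → ℤ) (x : Space) :
    wave k x = ∏ i, Complex.exp (Complex.I * (k i * x i)) := by
  rw [wave, Finset.mul_sum, Complex.exp_sum]

lemma wave_add (k l : Fin 3 → ℤ) (x : Space) : wave (k + l) x = wave k x * wave l x := by
  simp only [wave, ← Complex.exp_add]
  congr 1
  simp [Fin.sum_univ_three]
  ring

lemma norm_wave (k : Fin 3 → ℤ) (x : Space) : ‖wave k x‖ = 1 := by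
  have : wave k x = Complex.exp ((∑ i, (k i : ℝ) * x i : ℝ) * Complex.I) := by
    rw [wave, mul_comm]; push_cast; rfl
  rw [this, Complex.norm_exp_ofReal_mul_I]

lemma contDiff_wave (k : Fin 3 → ℤ) : ContDiff ℝ ∞ (wave k) := by
  unfold wave
  have : ∀ i, ContDiff ℝ ∞ fun x : Space => ((x i : ℝ) : ℂ) := fun i =>
    Complex.ofRealCLM.contDiff.comp (contDiff_apply ℝ ℝ i)
  fun_prop

lemma isPeriodic_wave (k : Fin 3 → ℤ) : IsPeriodic (wave k) := by
  intro x i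
  simp only [wave, Pi.add_apply, Complex.ofReal_add, mul_add, Finset.sum_add_distrib]
  rw [Complex.exp_add]
  have : ∑ j, (k j : ℂ) * ((Pi.single i (2 * Real.pi) : Space) j : ℂ) = k i * (2 * Real.pi) := by
    rw [Finset.sum_eq_single i]
    · simp
    · intro j _ hj; simp [hj]
    · simp
  rw [this, show Complex.I * ((k i : ℂ) * (2 * Real.pi)) = k i * (2 * Real.pi * Complex.I) by ring,
    Complex.exp_int_mul_two_pi_mul_I, mul_one]

/-- The Fourier coefficients of a product of functions of one variable are products. -/
lemma fourierCoef_prod (F : Fin 3 → ℝ → ℂ) (k : Fin 3 → ℤ) :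
    fourierCoef (fun x => ∏ i, F i (x i)) k = ∏ i, circleCoef (F i) (k i) := by
  simp only [fourierCoef, wave_eq_prod, ← Finset.prod_mul_distrib, cellMeasure_eq_pi]
  rw [integral_fintype_prod_eq_prod
    (fun i y => F i y * Complex.exp (Complex.I * (((-k) i : ℤ) * y)))]
  simp only [circleCoef, Finset.prod_mul_distrib, Finset.prod_const, Finset.card_univ,
    Fintype.card_fin, Pi.neg_apply]
  congr 1
  refine Finset.prod_congr rfl fun i _ => ?_
  rw [intervalIntegral.integral_of_le (by positivity), integral_Icc_eq_integral_Ioc]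

lemma circleCoef_exp (j n : ℤ) :
    circleCoef (fun x => Complex.exp (Complex.I * (j * x))) n = if j = n then 1 else 0 := by
  have hpi : ((2 * Real.pi : ℝ) : ℂ) ≠ 0 := by exact_mod_cast (by positivity : 2 * Real.pi ≠ 0)
  have h : ∀ x : ℝ, Complex.exp (Complex.I * (j * x)) * Complex.exp (Complex.I * ((-n : ℤ) * x))
      = Complex.exp ((Complex.I * (j - n : ℤ)) * x) := by
    intro x; rw [← Complex.exp_add]; push_cast; ring_nf
  simp only [circleCoef, h]
  split_ifs with hjn
  · subst hjn
    simp only [sub_self, Int.cast_zero, mul_zero, zero_mul, Complex.exp_zero,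
      intervalIntegral.integral_const, sub_zero, Complex.real_smul, mul_one]
    exact inv_mul_cancel₀ hpi
  · have hc : Complex.I * ((j - n : ℤ) : ℂ) ≠ 0 :=
      mul_ne_zero Complex.I_ne_zero (by exact_mod_cast sub_ne_zero.2 hjn)
    rw [integral_exp_mul_complex hc]
    have : Complex.exp (Complex.I * ((j - n : ℤ) : ℂ) * (2 * Real.pi : ℝ)) = 1 := by
      rw [← Complex.exp_int_mul_two_pi_mul_I (j - n)]
      congr 1; push_cast; ring
    rw [this]; simp

lemma fourierCoef_wave (j k : Fin 3 → ℤ) : fourierCoef (wave j) k = if j = k then 1 else 0 := by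
  have : wave j = fun x => ∏ i, (fun (i : Fin 3) (y : ℝ) =>
      Complex.exp (Complex.I * (j i * y))) i (x i) := by
    ext x; exact wave_eq_prod j x
  rw [this, fourierCoef_prod (fun i y => Complex.exp (Complex.I * (j i * y)))]
  simp only [circleCoef_exp, Finset.prod_ite_zero, Finset.prod_const_one]
  simp [funext_iff]

/-- An absolutely convergent Fourier series may be integrated termwise, so its coefficients are the
Fourier coefficients of its sum. -/
lemma circleCoef_of_hasSum {F : ℝ → ℂ} {c : ℤ → ℂ} (hc : Summable fun n => ‖c n‖)
    (hF : ∀ x : ℝ, HasSum (fun n : ℤ => c n * Complex.exp (Complex.I * (n * x))) (F x)) (n : ℤ) :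
    circleCoef F n = c n := by
  have hnorm : ∀ (j : ℤ) (x : ℝ), ‖Complex.exp (Complex.I * (j * x))‖ = 1 := by
    intro j x
    rw [show Complex.I * ((j : ℂ) * x) = ((j * x : ℝ) : ℂ) * Complex.I by push_cast; ring,
      Complex.norm_exp_ofReal_mul_I]
  have key := intervalIntegral.hasSum_integral_of_dominated_convergence
    (μ := volume) (a := 0) (b := 2 * Real.pi)
    (F := fun (j : ℤ) (x : ℝ) => c j * Complex.exp (Complex.I * (j * x)) *
      Complex.exp (Complex.I * ((-n : ℤ) * x)))
    (f := fun x => F x * Complex.exp (Complex.I * ((-n : ℤ) * x)))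
    (fun j _ => ‖c j‖)
    (fun j => by fun_prop)
    (fun j => Filter.Eventually.of_forall fun x _ => by
      rw [norm_mul, norm_mul, hnorm, hnorm, mul_one, mul_one])
    (Filter.Eventually.of_forall fun x _ => hc)
    (by simp)
    (Filter.Eventually.of_forall fun x _ => (hF x).mul_right _)
  have key2 := key.mul_left ((2 * Real.pi : ℝ) : ℂ)⁻¹
  have hterm : ∀ j : ℤ, ((2 * Real.pi : ℝ) : ℂ)⁻¹ * ∫ x in (0 : ℝ)..(2 * Real.pi),
      c j * Complex.exp (Complex.I * (j * x)) * Complex.exp (Complex.I * ((-n : ℤ) * x))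
      = if j = n then c n else 0 := by
    intro j
    have := circleCoef_exp j n
    rw [circleCoef] at this
    simp only [mul_assoc]
    rw [intervalIntegral.integral_const_mul, mul_left_comm, this]
    split_ifs with h <;> simp [h]
  simp only [hterm] at key2
  exact key2.unique (hasSum_ite_eq n (c n))

lemma integrable_mul_wave {f : Space → ℂ} (hf : Integrable f cellMeasure) (k : Fin 3 → ℤ) :
    Integrable (fun x => f x * wave k x) cellMeasure :=
  hf.mul_bdd (c := 1) (contDiff_wave k).continuous.aestronglyMeasurable
    (Filter.Eventually.of_forall fun x => (norm_wave k x).le)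

lemma integrable_wave (k : Fin 3 → ℤ) : Integrable (wave k) cellMeasure := by
  simpa using integrable_mul_wave (integrable_const (1 : ℂ)) k

lemma fourierCoef_add {f g : Space → ℂ} (hf : Integrable f cellMeasure)
    (hg : Integrable g cellMeasure) (k : Fin 3 → ℤ) :
    fourierCoef (fun x => f x + g x) k = fourierCoef f k + fourierCoef g k := by
  simp only [fourierCoef, add_mul]
  rw [integral_add (integrable_mul_wave hf _) (integrable_mul_wave hg _), mul_add]

lemma fourierCoef_const_mul (c : ℂ) (f : Space → ℂ) (k : Fin 3 → ℤ) :
    fourierCoef (fun x => c * f x) k = c * fourierCoef f k := by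
  simp only [fourierCoef, mul_assoc]
  rw [integral_const_mul, mul_left_comm]

lemma integrable_coe_Lp (f : Lp ℝ 2 cellMeasure) :
    Integrable (fun x => ((f x : ℝ) : ℂ)) cellMeasure :=
  ((Lp.memLp f).integrable (by norm_num)).ofReal

/-- A constant for which `‖f̂(k)‖ ≤ coefBound * ‖f‖_{L²}`. -/
def coefBound : ℝ := (2 * Real.pi)⁻¹ ^ 3 * (cellMeasure Set.univ ^ (1 / 2 : ℝ)).toReal

lemma norm_fourierCoef_le (f : Lp ℝ 2 cellMeasure) (k : Fin 3 → ℤ) :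
    ‖fourierCoef (fun x => ((f x : ℝ) : ℂ)) k‖ ≤ coefBound * ‖f‖ := by
  have h1 : ‖∫ x, ((f x : ℝ) : ℂ) * wave (-k) x ∂cellMeasure‖ ≤ ∫ x, ‖f x‖ ∂cellMeasure := by
    refine (norm_integral_le_integral_norm _).trans_eq ?_
    simp [norm_wave]
  have h2 : ∫ x, ‖f x‖ ∂cellMeasure = (eLpNorm f 1 cellMeasure).toReal := by
    rw [eLpNorm_one_eq_lintegral_enorm, integral_norm_eq_lintegral_enorm
      (Lp.aestronglyMeasurable f)]
  have h3 : eLpNorm f 1 cellMeasure ≤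
      eLpNorm f 2 cellMeasure * cellMeasure Set.univ ^ (1 / 2 : ℝ) := by
    refine (eLpNorm_le_eLpNorm_mul_rpow_measure_univ (by norm_num : (1 : ℝ≥0∞) ≤ 2)
      (Lp.aestronglyMeasurable f)).trans_eq ?_
    norm_num
  have h4 : (eLpNorm f 1 cellMeasure).toReal ≤
      ‖f‖ * (cellMeasure Set.univ ^ (1 / 2 : ℝ)).toReal := by
    rw [Lp.norm_def, ← ENNReal.toReal_mul]
    refine ENNReal.toReal_mono (ENNReal.mul_ne_top (Lp.eLpNorm_ne_top f) ?_) h3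
    exact ENNReal.rpow_ne_top_of_nonneg (by norm_num) (measure_ne_top _ _)
  rw [fourierCoef, norm_mul, norm_pow, norm_inv, Complex.norm_real, Real.norm_eq_abs,
    abs_of_pos (by positivity), coefBound, mul_assoc]
  gcongr
  linarith

/-- The Fourier coefficient as a continuous functional on real `L²`. -/
def coefCLM (k : Fin 3 → ℤ) : Lp ℝ 2 cellMeasure →L[ℝ] ℂ :=
  LinearMap.mkContinuous
    { toFun := fun f => fourierCoef (fun x => ((f x : ℝ) : ℂ)) k
      map_add' := fun f g => by
        rw [← fourierCoef_add (integrable_coe_Lp f) (integrable_coe_Lp g)]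
        simp only [fourierCoef]
        congr 1
        refine integral_congr_ae ?_
        filter_upwards [Lp.coeFn_add f g] with x hx
        simp only [hx, Pi.add_apply, Complex.ofReal_add]
      map_smul' := fun c f => by
        rw [RingHom.id_apply, Complex.real_smul, ← fourierCoef_const_mul]
        simp only [fourierCoef]
        congr 1
        refine integral_congr_ae ?_
        filter_upwards [Lp.coeFn_smul c f] with x hx
        simp only [hx, Pi.smul_apply, smul_eq_mul, Complex.ofReal_mul] }
    coefBound (fun f => norm_fourierCoef_le f k)

lemma coefCLM_apply (k : Fin 3 → ℤ) (f : Lp ℝ 2 cellMeasure) :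
    coefCLM k f = fourierCoef (fun x => ((f x : ℝ) : ℂ)) k := rfl

lemma integral_mul_wave_neg (f : Space → ℂ) (k : Fin 3 → ℤ) :
    ∫ x, f x * wave (-k) x ∂cellMeasure = ((2 * Real.pi : ℝ) : ℂ) ^ 3 * fourierCoef f k := by
  have hpi : ((2 * Real.pi : ℝ) : ℂ) ≠ 0 := by exact_mod_cast (by positivity : 2 * Real.pi ≠ 0)
  rw [fourierCoef, ← mul_assoc, ← mul_pow, mul_inv_cancel₀ hpi, one_pow, one_mul]

lemma vertDeriv_steadyState (a : ℝ) (m : ℕ) (x : Space) :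
    (vertDeriv (steadyState a m) x : ℂ) =
      (a * m / 2 : ℝ) * (wave (Pi.single 2 (m : ℤ)) x + wave (-Pi.single 2 (m : ℤ)) x) := by
  have h1 : vertDeriv (steadyState a m) x = a * (Real.cos (m * x 2) * m) := by
    have hd : HasDerivAt (fun t : ℝ => a * Real.sin (m * (x 2 + t)))
        (a * (Real.cos (m * (x 2 + 0)) * m)) 0 := by
      have := ((((hasDerivAt_id (0 : ℝ)).const_add (x 2)).const_mul (m : ℝ)).sin).const_mul a
      simpa using this
    rw [add_zero] at hd
    rw [vertDeriv, lineDeriv, ← hd.deriv]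
    congr 1
    ext t
    simp [steadyState]
  have h2 : wave (Pi.single 2 (m : ℤ)) x = Complex.exp ((m * x 2 : ℝ) * Complex.I) := by
    rw [wave, Fin.sum_univ_three]; simp; ring_nf
  have h3 : wave (-Pi.single 2 (m : ℤ)) x = Complex.exp (-(m * x 2 : ℝ) * Complex.I) := by
    rw [wave, Fin.sum_univ_three]; simp; ring_nf
  rw [h1, h2, h3]
  push_cast
  rw [Complex.cos]
  ring

/-- Multiplication by `∂₃Θ₀ = a m cos (m x₃)` shifts the vertical frequency by `± m`. -/
lemma pairL_wave (Ω β η a : ℝ) (m : ℕ) (f : Space → ℂ) (c : ℂ) (l : Fin 3 → ℤ) :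
    pairL Ω β η a m f (fun x => c * wave (-l) x) =
      -(((2 * Real.pi : ℝ) : ℂ) ^ 3 * (c * (a * m / 2 : ℝ) *
        (symbolM3 Ω β η (l - Pi.single 2 (m : ℤ)) * fourierCoef f (l - Pi.single 2 (m : ℤ)) +
         symbolM3 Ω β η (l + Pi.single 2 (m : ℤ)) * fourierCoef f (l + Pi.single 2 (m : ℤ))))) := by
  set e : Fin 3 → ℤ := Pi.single 2 (m : ℤ) with he
  have hprod : (fun x => (vertDeriv (steadyState a m) x : ℂ) * (c * wave (-l) x)) =
      fun x => (c * (a * m / 2 : ℝ)) * (wave (-(l - e)) x + wave (-(l + e)) x) := by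
    ext x
    rw [vertDeriv_steadyState, ← he, show -(l - e) = e + -l by abel,
      show -(l + e) = -e + -l by abel, wave_add, wave_add]
    ring
  have hcoef : ∀ k, fourierCoef (fun x => (vertDeriv (steadyState a m) x : ℂ) *
      (c * wave (-l) x)) (-k) = (c * (a * m / 2 : ℝ)) *
        ((if k = l - e then 1 else 0) + (if k = l + e then 1 else 0)) := by
    intro k
    rw [hprod, fourierCoef_const_mul, fourierCoef_add (integrable_wave _) (integrable_wave _),
      fourierCoef_wave, fourierCoef_wave]
    simp only [neg_inj, eq_comm]
  rw [pairL, pairM3]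
  simp only [hcoef]
  congr 2
  have hs := (((hasSum_ite_eq (l - e) (symbolM3 Ω β η (l - e) * fourierCoef f (l - e))).add
    (hasSum_ite_eq (l + e) (symbolM3 Ω β η (l + e) * fourierCoef f (l + e)))).mul_left
      (c * (a * m / 2 : ℝ))).tsum_eq
  rw [← hs]
  refine tsum_congr fun k => ?_
  have hite : ∀ q, (if k = q then (symbolM3 Ω β η q : ℂ) * fourierCoef f q else 0) =
      symbolM3 Ω β η k * fourierCoef f k * (if k = q then 1 else 0) := by
    intro q
    split_ifs with h
    · rw [h, mul_one]
    · rw [mul_zero]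
  rw [hite, hite]
  ring

/-! ### The Poisson kernel -/

/-- The Poisson kernel `(1 - r²) / (1 - 2 r cos x + r²)` of the unit disc, a function of the angle
`x`. -/
def poisson (r x : ℝ) : ℝ := (1 - r ^ 2) / (1 - 2 * r * Real.cos x + r ^ 2)

lemma poisson_denom_pos {r : ℝ} (h0 : 0 < r) (h1 : r < 1) (x : ℝ) :
    0 < 1 - 2 * r * Real.cos x + r ^ 2 := by
  have := Real.cos_le_one x
  nlinarith [mul_nonneg h0.le (sub_nonneg.2 this), pow_pos (sub_pos.2 h1) 2]

lemma hasSum_poisson {r : ℝ} (h0 : 0 < r) (h1 : r < 1) (x : ℝ) :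
    HasSum (fun n : ℤ => ((r ^ n.natAbs : ℝ) : ℂ) * Complex.exp (Complex.I * (n * x)))
      (poisson r x : ℂ) := by
  set u : ℂ := r * Complex.exp (Complex.I * x) with hu
  set v : ℂ := r * Complex.exp (-(Complex.I * x)) with hv
  have hnu : ‖u‖ < 1 := by
    rw [hu, norm_mul, mul_comm Complex.I, Complex.norm_exp_ofReal_mul_I]
    simpa [abs_of_pos h0] using h1
  have hnv : ‖v‖ < 1 := by
    rw [hv, norm_mul, show -(Complex.I * (x : ℂ)) = ((-x : ℝ) : ℂ) * Complex.I by push_cast; ring,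
      Complex.norm_exp_ofReal_mul_I]
    simpa [abs_of_pos h0] using h1
  have e1 : ∀ n : ℕ, ((r ^ (n : ℤ).natAbs : ℝ) : ℂ) * Complex.exp (Complex.I * ((n : ℤ) * x))
      = u ^ n := by
    intro n
    rw [hu, mul_pow, ← Complex.exp_nat_mul]
    simp only [Int.natAbs_natCast]
    push_cast
    congr 2; ring
  have e2 : ∀ n : ℕ, ((r ^ (-((n : ℤ) + 1)).natAbs : ℝ) : ℂ) *
      Complex.exp (Complex.I * ((-((n : ℤ) + 1) : ℤ) * x)) = v * v ^ n := by
    intro n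
    have : (-((n : ℤ) + 1)).natAbs = n + 1 := by omega
    rw [this, ← pow_succ', hv, mul_pow, ← Complex.exp_nat_mul]
    push_cast
    congr 2; ring
  have huv : u * v = (r : ℂ) ^ 2 := by
    rw [hu, hv, mul_mul_mul_comm, ← Complex.exp_add]; simp; ring
  have hupv : u + v = 2 * r * (Real.cos x : ℂ) := by
    rw [hu, hv, Complex.ofReal_cos, Complex.cos]; ring_nf
  have hu1 : 1 - u ≠ 0 := fun h => by
    rw [← sub_eq_zero.1 h] at hnu; simp at hnu
  have hv1 : 1 - v ≠ 0 := fun h => by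
    rw [← sub_eq_zero.1 h] at hnv; simp at hnv
  have hsum : (poisson r x : ℂ) = (1 - u)⁻¹ + v * (1 - v)⁻¹ := by
    have hd : (1 : ℂ) - 2 * r * (Real.cos x : ℂ) + r ^ 2 = (1 - u) * (1 - v) := by
      rw [← huv, ← hupv]; ring
    rw [poisson]
    push_cast
    push_cast at hd
    rw [hd, ← huv]
    field_simp
    ring
  rw [hsum]
  refine HasSum.of_nat_of_neg_add_one ?_ ?_
  · simp only [e1]; exact hasSum_geometric_of_norm_lt_one hnu
  · simp only [e2]; exact (hasSum_geometric_of_norm_lt_one hnv).mul_left v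

lemma circleCoef_poisson {r : ℝ} (h0 : 0 < r) (h1 : r < 1) (n : ℤ) :
    circleCoef (fun x => (poisson r x : ℂ)) n = ((r ^ n.natAbs : ℝ) : ℂ) := by
  refine circleCoef_of_hasSum ?_ (fun x => hasSum_poisson h0 h1 x) n
  have hs : Summable fun n : ℕ => r ^ n := summable_geometric_of_lt_one h0.le h1
  refine Summable.of_nat_of_neg_add_one ?_ ?_
  · simpa [abs_of_pos h0] using hs
  · refine ((summable_nat_add_iff 1).2 hs).congr fun n => ?_
    have : (-((n : ℤ) + 1)).natAbs = n + 1 := by omega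
    rw [this]
    simp [abs_of_pos h0]

/-! ### Weak solutions of scalar ODEs -/

/-- If `y' = g` on `[0,T)` and `y(0) = y₀` in the sense of distributions, then `y` is almost
everywhere the primitive of `g` that starts at `y₀`. -/
lemma ae_eq_primitive_of_weak {T : ℝ} (hT : 0 < T) {y g : ℝ → ℝ} {y₀ : ℝ}
    (hy : IntegrableOn y (Set.Ioo 0 T)) (hg : IntegrableOn g (Set.Ioo 0 T))
    (h : ∀ χ : ℝ → ℝ, ContDiff ℝ ∞ χ → (∃ S < T, ∀ t, S ≤ t → χ t = 0) →
      (∫ t in Set.Ioo 0 T, (y t * deriv χ t + g t * χ t)) + y₀ * χ 0 = 0) :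
    ∀ᵐ t, t ∈ Set.Ioo 0 T → y t = y₀ + ∫ s in (0 : ℝ)..t, g s := by
  have toIoo : ∀ f : ℝ → ℝ, ∫ t in Set.Ioo 0 T, f t = ∫ t in (0 : ℝ)..T, f t := fun f => by
    rw [intervalIntegral.integral_of_le hT.le, integral_Ioc_eq_integral_Ioo]
  have hyI : IntervalIntegrable y volume 0 T :=
    (intervalIntegrable_iff_integrableOn_Ioo_of_le hT.le).2 hy
  have hgI : IntervalIntegrable g volume 0 T :=
    (intervalIntegrable_iff_integrableOn_Ioo_of_le hT.le).2 hg
  set G : ℝ → ℝ := fun t => ∫ s in (0 : ℝ)..t, g s with hG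
  have hGac : AbsolutelyContinuousOnInterval G 0 T :=
    hgI.absolutelyContinuousOnInterval_intervalIntegral (c := 0) (by simp)
  have hGcont : ContinuousOn G (Set.uIcc 0 T) := hGac.continuousOn
  have hGI : IntervalIntegrable G volume 0 T := hGcont.intervalIntegrable
  have hFI : IntervalIntegrable (fun t => y t - (y₀ + G t)) volume 0 T :=
    hyI.sub (intervalIntegrable_const.add hGI)
  suffices H : ∀ᵐ t, t ∈ Set.Ioo 0 T → y t - (y₀ + G t) = 0 by
    filter_upwards [H] with t ht hmem
    linarith [ht hmem]
  refine isOpen_Ioo.ae_eq_zero_of_integral_contDiff_smul_eq_zero ?_ ?_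
  · exact ((intervalIntegrable_iff_integrableOn_Ioo_of_le hT.le).1 hFI).locallyIntegrableOn
  · intro ψ hψ hψc hψs
    set χ : ℝ → ℝ := fun t => ∫ s in T..t, ψ s with hχ
    have hderiv : ∀ t, HasDerivAt χ (ψ t) t := fun t =>
      intervalIntegral.integral_hasDerivAt_right (hψ.continuous.intervalIntegrable _ _)
        (hψ.continuous.stronglyMeasurableAtFilter _ _) hψ.continuous.continuousAt
    have hdχ : deriv χ = ψ := funext fun t => (hderiv t).deriv
    have hχs : ContDiff ℝ ∞ χ := by
      rw [contDiff_infty_iff_deriv, hdχ]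
      exact ⟨fun t => (hderiv t).differentiableAt, hψ⟩
    have hψ0 : ∃ S < T, ∀ t, S ≤ t → ψ t = 0 := by
      rcases (tsupport ψ).eq_empty_or_nonempty with he | hne
      · refine ⟨T - 1, by linarith, fun t _ => image_eq_zero_of_notMem_tsupport ?_⟩
        simp [he]
      · obtain ⟨S', hS', hmax⟩ := hψc.isCompact.exists_isGreatest hne
        have hS'T := (hψs hS').2
        refine ⟨(S' + T) / 2, by linarith, fun t ht => image_eq_zero_of_notMem_tsupport ?_⟩
        intro hmem
        have := hmax hmem
        linarith
    obtain ⟨S, hST, hS⟩ := hψ0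
    have hχ0 : ∀ t, S ≤ t → χ t = 0 := fun t ht => by
      rw [hχ]
      refine intervalIntegral.integral_zero_ae (Filter.Eventually.of_forall fun s hs => hS s ?_)
      exact (le_min hST.le ht).trans hs.1.le
    have hweak := h χ hχs ⟨S, hST, hχ0⟩
    rw [toIoo, hdχ] at hweak
    have hsupp : ∫ t, ψ t • (y t - (y₀ + G t)) = ∫ t in (0 : ℝ)..T, ψ t * (y t - (y₀ + G t)) := by
      rw [← toIoo]
      refine (setIntegral_eq_integral_of_forall_compl_eq_zero fun t ht => ?_).symm
      rw [image_eq_zero_of_notMem_tsupport fun hm => ht (hψs hm), zero_smul]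
    have hχc : Continuous χ := hχs.continuous
    have hχac : AbsolutelyContinuousOnInterval χ 0 T :=
      (hψ.continuous.intervalIntegrable 0 T).absolutelyContinuousOnInterval_intervalIntegral
        (c := T) (by simp)
    have hparts := hGac.integral_mul_deriv_eq_deriv_mul hχac
    have hdG : ∫ t in (0 : ℝ)..T, deriv G t * χ t = ∫ t in (0 : ℝ)..T, g t * χ t := by
      refine intervalIntegral.integral_congr_ae ?_
      filter_upwards [hgI.ae_hasDerivAt_integral] with t ht hmem
      rw [(ht (Set.uIoc_subset_uIcc hmem) 0 (by simp)).deriv]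
    have hψint : ∫ t in (0 : ℝ)..T, ψ t = - χ 0 := by
      rw [hχ, intervalIntegral.integral_symm]
    rw [hdχ, hdG, hχ0 T hST.le] at hparts
    have hG0 : G 0 = 0 := by simp [hG]
    rw [hG0] at hparts
    have i1 : IntervalIntegrable (fun t => y t * ψ t) volume 0 T :=
      hyI.mul_continuousOn hψ.continuous.continuousOn
    have i2 : IntervalIntegrable (fun t => g t * χ t) volume 0 T :=
      hgI.mul_continuousOn hχc.continuousOn
    have i3 : IntervalIntegrable (fun t => G t * ψ t) volume 0 T :=
      hGI.mul_continuousOn hψ.continuous.continuousOn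
    have i4 : IntervalIntegrable (fun t => y₀ * ψ t) volume 0 T :=
      (hψ.continuous.intervalIntegrable _ _).const_mul y₀
    rw [intervalIntegral.integral_add i1 i2] at hweak
    rw [hsupp, show (fun t => ψ t * (y t - (y₀ + G t))) =
        fun t => (y t * ψ t - y₀ * ψ t) - G t * ψ t by ext t; ring,
      intervalIntegral.integral_sub (i1.sub i4) i3, intervalIntegral.integral_sub i1 i4,
      intervalIntegral.integral_const_mul, hψint]
    linarith

/-! ### Comparison for infinite chains of ODEs -/

/-- **Comparison principle** for a chain of integral inequalities with nonnegative coupling between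
neighbours. Since `p 0 = 0`, the component `d 0` does not act on the others and its sign is
irrelevant. Iterating the inequality, the negative part is bounded by every term of an exponential
series. -/
lemma chain_nonneg {T B C : ℝ} {p : ℕ → ℝ} {d : ℕ → ℝ → ℝ} (hB : 0 ≤ B) (hC : 0 ≤ C)
    (hp0 : p 0 = 0) (hp : ∀ j, 0 ≤ p j) (hpC : ∀ j, p j ≤ C)
    (hcont : ∀ j, ContinuousOn (d j) (Set.Icc 0 T))
    (hbd : ∀ j, ∀ t ∈ Set.Icc 0 T, |d j t| ≤ B)
    (hd : ∀ j, ∀ t ∈ Set.Icc 0 T,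
      ∫ s in (0 : ℝ)..t, (p j * d j s + p (j + 2) * d (j + 2) s) ≤ d (j + 1) t) :
    ∀ j, ∀ t ∈ Set.Icc 0 T, 0 ≤ d (j + 1) t := by
  have key : ∀ n : ℕ, ∀ j, ∀ t ∈ Set.Icc 0 T,
      -(B * ((2 * C * t) ^ n / n.factorial)) ≤ d (j + 1) t := by
    intro n
    induction n with
    | zero =>
      intro j t ht
      simpa using neg_le_of_abs_le (hbd (j + 1) t ht)
    | succ n ih =>
      intro j t ht
      refine le_trans ?_ (hd j t ht)
      have hsub : Set.uIcc 0 t ⊆ Set.Icc 0 T := by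
        rw [Set.uIcc_of_le ht.1]; exact Set.Icc_subset_Icc_right ht.2
      have hint : ∫ s in (0 : ℝ)..t, -(2 * C * B * ((2 * C * s) ^ n / n.factorial))
          = -(B * ((2 * C * t) ^ (n + 1) / (n + 1).factorial)) := by
        have : ∀ s : ℝ, -(2 * C * B * ((2 * C * s) ^ n / n.factorial))
            = -(2 * C * B * (2 * C) ^ n / n.factorial) * s ^ n := fun s => by
          rw [mul_pow]; ring
        simp only [this]
        rw [intervalIntegral.integral_const_mul, integral_pow, Nat.factorial_succ]
        push_cast
        have : (n.factorial : ℝ) ≠ 0 := by positivity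
        have : (n : ℝ) + 1 ≠ 0 := by positivity
        field_simp
        simp
        ring
      rw [← hint]
      refine intervalIntegral.integral_mono_on ht.1 (Continuous.intervalIntegrable (by fun_prop) _ _)
        (((continuousOn_const.mul (hcont j)).add
          (continuousOn_const.mul (hcont (j + 2)))).mono hsub).intervalIntegrable ?_
      intro s hs
      have hsT : s ∈ Set.Icc 0 T := ⟨hs.1, hs.2.trans ht.2⟩
      set e := B * ((2 * C * s) ^ n / n.factorial) with he
      have he0 : 0 ≤ e := by
        have := hs.1
        positivity
      -- each of the two terms contributes at least `-C * e`
      have step : ∀ i, (i = 0 ∨ -e ≤ d i s) → -(C * e) ≤ p i * d i s := by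
        intro i hi
        rcases hi with rfl | hi
        · rw [hp0, zero_mul]; exact neg_nonpos.2 (mul_nonneg hC he0)
        · nlinarith [hp i, hpC i]
      have h1 := step j (by
        rcases j with _ | j
        · exact Or.inl rfl
        · exact Or.inr (ih j s hsT))
      have h2 := step (j + 2) (Or.inr (ih (j + 1) s hsT))
      rw [show -(2 * C * B * ((2 * C * s) ^ n / n.factorial)) = -(C * e) + -(C * e) by
        rw [he]; ring]
      exact add_le_add h1 h2
  intro j t ht
  have hlim := ((FloorSemiring.tendsto_pow_div_factorial_atTop (2 * C * t)).const_mul B).neg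
  rw [mul_zero, neg_zero] at hlim
  exact le_of_tendsto' hlim fun n => key n j t ht

/-- A nonnegative chain `z' (j+1) = p j * z j + p (j+2) * z (j+2)` whose components `1` and `2` start
above `ε` grows at least like `ε * exp (γ t)`, where `γ` bounds `p 1` and `p 2` from below: the
sequence with components `1` and `2` equal to `ε * exp (γ t)` and the others `0` is a subsolution. -/
lemma chain_growth {T A B C γ ε : ℝ} {p z₀ : ℕ → ℝ} {z : ℕ → ℝ → ℝ}
    (hT : 0 < T) (hB : 0 ≤ B) (hε : 0 ≤ ε) (hγ : 0 ≤ γ)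
    (hp0 : p 0 = 0) (hp : ∀ j, 0 ≤ p j) (hpC : ∀ j, p j ≤ C) (hp1 : γ ≤ p 1) (hp2 : γ ≤ p 2)
    (hz₀ : ∀ j, 0 ≤ z₀ j) (hz₀A : ∀ j, z₀ j ≤ A) (hz1 : ε ≤ z₀ 1) (hz2 : ε ≤ z₀ 2)
    (hint : ∀ j, IntegrableOn (z j) (Set.Ioo 0 T))
    (hbd : ∀ j, ∀ᵐ t, t ∈ Set.Ioo 0 T → |z j t| ≤ B)
    (hz : ∀ j, ∀ᵐ t, t ∈ Set.Ioo 0 T →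
      z (j + 1) t = z₀ (j + 1) + ∫ s in (0 : ℝ)..t, (p j * z j s + p (j + 2) * z (j + 2) s)) :
    ∀ᵐ t, t ∈ Set.Ioo 0 T → ε * Real.exp (γ * t) ≤ z 1 t := by
  have hC : 0 ≤ C := (hp 0).trans (hpC 0)
  have hA : 0 ≤ A := (hz₀ 0).trans (hz₀A 0)
  have hzI : ∀ j, IntervalIntegrable (z j) volume 0 T := fun j =>
    (intervalIntegrable_iff_integrableOn_Ioo_of_le hT.le).2 (hint j)
  have hzt : ∀ j, ∀ t ∈ Set.Icc 0 T, IntervalIntegrable (z j) volume 0 t := fun j t ht =>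
    (hzI j).mono_set (by
      rw [Set.uIcc_of_le ht.1, Set.uIcc_of_le hT.le]; exact Set.Icc_subset_Icc_right ht.2)
  -- the continuous representatives
  set Z : ℕ → ℝ → ℝ := fun j t =>
    z₀ (j + 1) + ∫ s in (0 : ℝ)..t, (p j * z j s + p (j + 2) * z (j + 2) s) with hZ
  have hrhs : ∀ j, IntervalIntegrable (fun s => p j * z j s + p (j + 2) * z (j + 2) s) volume 0 T :=
    fun j => ((hzI j).const_mul _).add ((hzI (j + 2)).const_mul _)
  have hZcont : ∀ j, ContinuousOn (Z j) (Set.Icc 0 T) := fun j => by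
    have := ((hrhs j).absolutelyContinuousOnInterval_intervalIntegral (c := 0) (by simp)).continuousOn
    rw [Set.uIcc_of_le hT.le] at this
    exact continuousOn_const.add this
  have hZbd : ∀ j, ∀ t ∈ Set.Icc 0 T, |Z j t| ≤ A + 2 * C * B * T := fun j t ht => by
    have h1 : |z₀ (j + 1)| ≤ A := by rw [abs_of_nonneg (hz₀ _)]; exact hz₀A _
    have h2 : ‖∫ s in (0 : ℝ)..t, (p j * z j s + p (j + 2) * z (j + 2) s)‖
        ≤ 2 * C * B * |t - 0| := by
      refine intervalIntegral.norm_integral_le_of_norm_le_const_ae ?_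
      have hne : ∀ᵐ s : ℝ, s ≠ T := by simp [ae_iff]
      filter_upwards [hbd j, hbd (j + 2), hne] with s h1 h2 hne hs
      rw [Set.uIoc_of_le ht.1] at hs
      have hsT : s ∈ Set.Ioo 0 T := ⟨hs.1, lt_of_le_of_ne (hs.2.trans ht.2) hne⟩
      refine (norm_add_le _ _).trans ?_
      rw [norm_mul, norm_mul, Real.norm_eq_abs, Real.norm_eq_abs, Real.norm_eq_abs,
        Real.norm_eq_abs, abs_of_nonneg (hp _), abs_of_nonneg (hp _)]
      have := mul_le_mul (hpC j) (h1 hsT) (abs_nonneg _) hC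
      have := mul_le_mul (hpC (j + 2)) (h2 hsT) (abs_nonneg _) hC
      linarith
    rw [sub_zero, abs_of_nonneg ht.1, Real.norm_eq_abs] at h2
    have h3 : 2 * C * B * t ≤ 2 * C * B * T := mul_le_mul_of_nonneg_left ht.2 (by positivity)
    exact (abs_add_le _ _).trans (by linarith)
  -- the subsolution
  set u : ℕ → ℝ → ℝ := fun j t => if j = 1 ∨ j = 2 then ε * Real.exp (γ * t) else 0 with hu
  have hucont : ∀ j, Continuous (u j) := fun j => by
    by_cases h : j = 1 ∨ j = 2 <;> simp only [hu, h, if_true, if_false] <;> fun_prop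
  have hu0 : ∀ j t, 0 ≤ u j t := fun j t => by
    simp only [hu]; split_ifs <;> positivity
  have hubd : ∀ j, ∀ t ∈ Set.Icc 0 T, |u j t| ≤ ε * Real.exp (γ * T) := fun j t ht => by
    rw [abs_of_nonneg (hu0 j t)]
    simp only [hu]
    split_ifs
    · have := ht.2
      gcongr
    · positivity
  have huexp : ∀ t, γ * ∫ s in (0 : ℝ)..t, ε * Real.exp (γ * s) = ε * Real.exp (γ * t) - ε := by
    intro t
    rw [← intervalIntegral.integral_const_mul]
    have hd : ∀ s ∈ Set.uIcc 0 t,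
        HasDerivAt (fun s => ε * Real.exp (γ * s)) (γ * (ε * Real.exp (γ * s))) s := fun s _ => by
      have e : HasDerivAt (fun s => γ * s) γ s := by simpa using (hasDerivAt_id s).const_mul γ
      exact (e.exp.const_mul ε).congr_deriv (by ring)
    rw [intervalIntegral.integral_eq_sub_of_hasDerivAt hd
      (Continuous.intervalIntegrable (by fun_prop) _ _)]
    simp
  have husub : ∀ j, ∀ t ∈ Set.Icc 0 T, u (j + 1) t ≤
      z₀ (j + 1) + ∫ s in (0 : ℝ)..t, (p j * u j s + p (j + 2) * u (j + 2) s) := by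
    intro j t ht
    have hE : 0 ≤ ∫ s in (0 : ℝ)..t, ε * Real.exp (γ * s) :=
      intervalIntegral.integral_nonneg ht.1 fun s _ => by positivity
    have hI := huexp t
    rw [intervalIntegral.integral_const_mul] at hI hE
    rcases j with _ | _ | j
    · simp only [hu, zero_add, true_or, if_true, or_true, hp0, zero_mul,
        intervalIntegral.integral_const_mul]
      linarith [mul_le_mul_of_nonneg_right hp2 hE]
    · simp [hu, intervalIntegral.integral_const_mul]
      linarith [mul_le_mul_of_nonneg_right hp1 hE]
    · have h0 : u (j + 1 + 1 + 1) t = 0 := by simp [hu]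
      rw [h0]
      refine add_nonneg (hz₀ _) (intervalIntegral.integral_nonneg ht.1 fun s _ => ?_)
      exact add_nonneg (mul_nonneg (hp _) (hu0 _ _)) (mul_nonneg (hp _) (hu0 _ _))
  -- comparison of the two; the component `0` plays no role
  set d : ℕ → ℝ → ℝ := fun j t => match j with
    | 0 => 0
    | j + 1 => Z j t - u (j + 1) t with hd
  have hcomp := chain_nonneg (T := T) (B := A + 2 * C * B * T + ε * Real.exp (γ * T)) (C := C)
    (p := p) (d := d) (by positivity) hC hp0 hp hpC
    (fun j => by
      rcases j with _ | j
      · exact continuousOn_const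
      · exact (hZcont j).sub (hucont (j + 1)).continuousOn)
    (fun j t ht => by
      rcases j with _ | j
      · simp only [hd, abs_zero]; positivity
      · exact (abs_sub _ _).trans (add_le_add (hZbd j t ht) (hubd (j + 1) t ht)))
    (fun j t ht => by
      have hui : ∀ j, IntervalIntegrable (u j) volume 0 t := fun j =>
        (hucont j).intervalIntegrable _ _
      have hcongr : ∫ s in (0 : ℝ)..t, (p j * d j s + p (j + 2) * d (j + 2) s) =
          ∫ s in (0 : ℝ)..t, ((p j * z j s + p (j + 2) * z (j + 2) s) -
            (p j * u j s + p (j + 2) * u (j + 2) s)) := by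
        have hpd : ∀ i, ∀ᵐ s, s ∈ Set.Ioo 0 T → p i * d i s = p i * z i s - p i * u i s := by
          intro i
          rcases i with _ | i
          · simp [hp0]
          · filter_upwards [hz i] with s hs hsT
            rw [hs hsT, ← mul_sub]
        refine intervalIntegral.integral_congr_ae ?_
        have hne : ∀ᵐ s : ℝ, s ≠ T := by simp [ae_iff]
        filter_upwards [hpd j, hpd (j + 2), hne] with s h1 h2 hne hs
        rw [Set.uIoc_of_le ht.1] at hs
        have hsT : s ∈ Set.Ioo 0 T := ⟨hs.1, lt_of_le_of_ne (hs.2.trans ht.2) hne⟩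
        rw [h1 hsT, h2 hsT]; ring
      rw [hcongr, intervalIntegral.integral_sub
        (((hzt j t ht).const_mul _).add ((hzt (j + 2) t ht).const_mul _))
        (((hui j).const_mul _).add ((hui (j + 2)).const_mul _))]
      have := husub j t ht
      simp only [hd, hZ]
      linarith)
  filter_upwards [hz 0] with t ht htT
  have h1 := hcomp 0 t (Set.Ioo_subset_Icc_self htT)
  rw [ht htT]
  have h2 : u 1 t = ε * Real.exp (γ * t) := by simp [hu]
  have h3 : 0 ≤ Z 0 t - u (0 + 1) t := h1
  rw [zero_add, h2] at h3
  simpa [hZ] using h3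

/-! ### The equation in Fourier variables -/

/-- Tested with `χ(t) exp(-i l·x)`, the equation becomes a scalar weak ODE for the `l`-th Fourier
coefficient, driven by the coefficients at the vertical neighbours `l ± m e₃`. -/
lemma IsSolution.weak_mode {Ω β η a T : ℝ} {m : ℕ} {θ₀ : Space → ℝ}
    {θ : ℝ → Lp ℝ 2 cellMeasure} (hT : 0 < T) (h : IsSolution Ω β η a m T θ₀ θ)
    (hint : ∀ k, IntegrableOn (fun t => coefCLM k (θ t)) (Set.Ioo 0 T))
    (l : Fin 3 → ℤ) (χ : ℝ → ℝ) (hχ : ContDiff ℝ ∞ χ) (hχ0 : ∃ S < T, ∀ t, S ≤ t → χ t = 0) :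
    (∫ t in Set.Ioo 0 T, ((coefCLM l (θ t)).re * deriv χ t +
      -(a * m / 2 * symbolM3 Ω β η (l - Pi.single 2 (m : ℤ)) *
          (coefCLM (l - Pi.single 2 (m : ℤ)) (θ t)).re +
        a * m / 2 * symbolM3 Ω β η (l + Pi.single 2 (m : ℤ)) *
          (coefCLM (l + Pi.single 2 (m : ℤ)) (θ t)).re) * χ t)) +
      (fourierCoef (fun x => (θ₀ x : ℂ)) l).re * χ 0 = 0 := by
  set e : Fin 3 → ℤ := Pi.single 2 (m : ℤ) with he
  have hpi : ((2 * Real.pi : ℝ) : ℂ) ^ 3 ≠ 0 :=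
    pow_ne_zero _ (by exact_mod_cast (by positivity : 2 * Real.pi ≠ 0))
  have hφ : IsTestFunction T (fun t x => (χ t : ℂ) * wave (-l) x) := by
    refine ⟨?_, fun t x i => ?_, ?_⟩
    · have h1 : ContDiff ℝ ∞ (fun q : ℝ × Space => (χ q.1 : ℂ)) :=
        Complex.ofRealCLM.contDiff.comp (hχ.comp contDiff_fst)
      exact h1.mul ((contDiff_wave (-l)).comp contDiff_snd)
    · simp only
      rw [isPeriodic_wave (-l) x i]
    · obtain ⟨S, hS, h0⟩ := hχ0
      exact ⟨S, hS, fun t ht x => by simp [h0 t ht]⟩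
  have key := h.2 _ hφ
  have hd : ∀ (t : ℝ) (x : Space), deriv (fun r => (χ r : ℂ) * wave (-l) x) t =
      ((deriv χ t : ℝ) : ℂ) * wave (-l) x := fun t x =>
    (((hχ.differentiable (by simp)) t).hasDerivAt.ofReal_comp.mul_const _).deriv
  have hpull : ∀ (f : Space → ℂ) (c : ℂ), ∫ x, f x * (c * wave (-l) x) ∂cellMeasure =
      ((2 * Real.pi : ℝ) : ℂ) ^ 3 * (c * fourierCoef f l) := fun f c => by
    rw [mul_left_comm, ← integral_mul_wave_neg, ← integral_const_mul]
    simp only [mul_left_comm]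
  simp only [hd, hpull, pairL_wave, ← he, ← coefCLM_apply] at key
  simp only [← mul_neg, ← mul_add] at key
  rw [integral_const_mul, ← mul_add] at key
  replace key := (mul_eq_zero.1 key).resolve_left hpi
  -- real parts
  have hI : ∀ k (f : ℝ → ℝ), Continuous f →
      IntegrableOn (fun t => (f t : ℂ) * coefCLM k (θ t)) (Set.Ioo 0 T) := by
    intro k f hf
    have := (intervalIntegrable_iff_integrableOn_Ioo_of_le hT.le).2 (hint k)
    exact (intervalIntegrable_iff_integrableOn_Ioo_of_le hT.le).1
      (this.continuousOn_mul (Complex.continuous_ofReal.comp hf).continuousOn)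
  have hdc : Continuous (deriv χ) := hχ.continuous_deriv (by simp)
  have hre := congrArg Complex.reCLM key
  rw [map_add, map_zero, ← ContinuousLinearMap.integral_comp_comm] at hre
  · simp only [Complex.reCLM_apply, Complex.add_re, Complex.re_ofReal_mul] at hre
    rw [mul_comm (fourierCoef _ _).re]
    refine (congrArg (· + _) ?_).trans hre
    refine integral_congr_ae (Filter.Eventually.of_forall fun t => ?_)
    simp only [← Complex.ofReal_mul, Complex.re_ofReal_mul, Complex.neg_re,
      Complex.add_re]
    ring
  · refine (hI l _ hdc).add ?_
    have h1 := ((hI (l - e) χ hχ.continuous).const_mul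
      (-((a * m / 2 : ℝ) : ℂ) * symbolM3 Ω β η (l - e))).add
      ((hI (l + e) χ hχ.continuous).const_mul (-((a * m / 2 : ℝ) : ℂ) * symbolM3 Ω β η (l + e)))
    refine h1.congr (Filter.Eventually.of_forall fun t => ?_)
    simp only [Pi.add_apply]
    ring

/-! ### The symbol of `M₃` along a parabola of frequencies -/

/-- The frequency `(n², n, j m)`. The horizontal part is chosen on the parabola `k₁ = k₂²`, along
which the symbol of `M₃` grows like `|k|`. -/
def mode (n m j : ℕ) : Fin 3 → ℤ := ![(n : ℤ) ^ 2, n, j * m]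

lemma mode_sub (n m j : ℕ) : mode n m (j + 1) - Pi.single 2 (m : ℤ) = mode n m j := by
  ext i; fin_cases i <;> simp [mode]; ring

lemma mode_add (n m j : ℕ) : mode n m (j + 1) + Pi.single 2 (m : ℤ) = mode n m (j + 2) := by
  ext i; fin_cases i <;> simp [mode]; ring

lemma symbolM3_mode_zero (Ω β η : ℝ) (n m : ℕ) : symbolM3 Ω β η (mode n m 0) = 0 := by
  simp [symbolM3, mode]

lemma normSq_mode (n m j : ℕ) :
    normSq (mode n m j) = (n : ℝ) ^ 4 + (n : ℝ) ^ 2 + ((j : ℝ) * m) ^ 2 := by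
  simp [normSq, mode, Fin.sum_univ_three]; ring

lemma symbolM3_mode_nonneg {Ω β η : ℝ} (hη : 0 < η) (n m j : ℕ) :
    0 ≤ symbolM3 Ω β η (mode n m j) := by
  rw [symbolM3, normSq_mode]
  split_ifs <;> positivity

/-- For fixed `n` the symbol is bounded uniformly in the vertical frequency, so that the chain of
ODEs on the horizontal frequency `(n², n)` has a bounded coupling. -/
lemma symbolM3_mode_le {Ω β η : ℝ} (hβ : 0 < β) (hη : 0 < η) {n : ℕ} (hn : 0 < n) (m j : ℕ) :
    symbolM3 Ω β η (mode n m j) ≤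
      (β ^ 2 / η) * (n : ℝ) ^ 2 * (((n : ℝ) ^ 2) ^ 2 + (n : ℝ) ^ 2) /
        ((β ^ 2 / η) ^ 2 * (n : ℝ) ^ 4) := by
  have hn' : (0 : ℝ) < n := by exact_mod_cast hn
  rw [symbolM3, normSq_mode]
  split_ifs
  · positivity
  · simp only [mode, Matrix.cons_val_zero, Matrix.cons_val_one, Matrix.cons_val, Int.cast_pow,
      Int.cast_natCast]
    gcongr
    have : 0 ≤ 4 * Ω ^ 2 * ((j * m : ℤ) : ℝ) ^ 2 * ((n : ℝ) ^ 4 + (n : ℝ) ^ 2 + (j * m) ^ 2) := by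
      positivity
    linarith

/-- The constant in the lower bound `symbolM3 ≥ symbolRate * n²` at `(n², n, m)` and
`(n², n, 2m)`. -/
def symbolRate (Ω β η : ℝ) (m : ℕ) : ℝ :=
  (β ^ 2 / η) / (16 * Ω ^ 2 * m ^ 2 * (2 + 4 * m ^ 2) + (β ^ 2 / η) ^ 2)

lemma le_symbolM3_mode {Ω β η : ℝ} (hβ : 0 < β) (hη : 0 < η) {n m j : ℕ}
    (hn : 0 < n) (hm : 0 < m) (hj : 0 < j) (hj2 : j ≤ 2) :
    symbolRate Ω β η m * (n : ℝ) ^ 2 ≤ symbolM3 Ω β η (mode n m j) := by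
  have hn' : (1 : ℝ) ≤ n := by exact_mod_cast hn
  have hm' : (0 : ℝ) < m := by exact_mod_cast hm
  have hj' : (0 : ℝ) < j := by exact_mod_cast hj
  have hj2' : (j : ℝ) ≤ 2 := by exact_mod_cast hj2
  have h2 : mode n m j 2 ≠ 0 := by simp [mode]; omega
  rw [symbolM3, if_neg h2, normSq_mode]
  simp only [mode, Matrix.cons_val_zero, Matrix.cons_val_one, Matrix.cons_val, Int.cast_pow,
    Int.cast_natCast, Int.cast_mul]
  set μ := β ^ 2 / η with hμ
  have hμ0 : 0 < μ := by positivity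
  have hjm : ((j : ℝ) * m) ^ 2 ≤ 4 * (m : ℝ) ^ 2 := by
    calc ((j : ℝ) * m) ^ 2 ≤ (2 * (m : ℝ)) ^ 2 := by gcongr
      _ = _ := by ring
  have hn4 : (n : ℝ) ^ 2 ≤ (n : ℝ) ^ 4 := pow_le_pow_right₀ hn' (by norm_num)
  have hn1 : (1 : ℝ) ≤ (n : ℝ) ^ 4 := one_le_pow₀ hn'
  have hden : 4 * Ω ^ 2 * ((j : ℝ) * m) ^ 2 * ((n : ℝ) ^ 4 + (n : ℝ) ^ 2 + ((j : ℝ) * m) ^ 2) +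
      μ ^ 2 * (n : ℝ) ^ 4 ≤ (16 * Ω ^ 2 * m ^ 2 * (2 + 4 * m ^ 2) + μ ^ 2) * (n : ℝ) ^ 4 := by
    have h3 : (n : ℝ) ^ 4 + (n : ℝ) ^ 2 + ((j : ℝ) * m) ^ 2 ≤ (2 + 4 * (m : ℝ) ^ 2) * (n : ℝ) ^ 4 := by
      nlinarith [mul_le_mul_of_nonneg_left hn1 (by positivity : 0 ≤ 4 * (m : ℝ) ^ 2)]
    calc _ ≤ 4 * Ω ^ 2 * (4 * (m : ℝ) ^ 2) * ((2 + 4 * (m : ℝ) ^ 2) * (n : ℝ) ^ 4) +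
          μ ^ 2 * (n : ℝ) ^ 4 := by gcongr
      _ = _ := by ring
  rw [le_div_iff₀ (by positivity)]
  calc symbolRate Ω β η m * (n : ℝ) ^ 2 * _
      ≤ symbolRate Ω β η m * (n : ℝ) ^ 2 *
        ((16 * Ω ^ 2 * m ^ 2 * (2 + 4 * m ^ 2) + μ ^ 2) * (n : ℝ) ^ 4) := by
        refine mul_le_mul_of_nonneg_left hden ?_
        rw [symbolRate]; positivity
    _ = μ * (n : ℝ) ^ 2 * (n : ℝ) ^ 4 := by
        rw [symbolRate, ← hμ]; field_simp
    _ ≤ μ * (n : ℝ) ^ 2 * (((n : ℝ) ^ 2) ^ 2 + (n : ℝ) ^ 2) := by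
        refine mul_le_mul_of_nonneg_left ?_ (by positivity)
        nlinarith [sq_nonneg (n : ℝ)]

/-! ### The initial datum -/

/-- The initial datum: a product of Poisson kernels in the horizontal variables, whose Fourier
coefficients decay only like `r ^ (|k₁| + |k₂|)`, and a vertical profile of zero mean. The signs in
the profile make the coefficients of the datum nonnegative after multiplication by `(-1) ^ j`. -/
def datum (r : ℝ) (m : ℕ) (x : Space) : ℝ :=
  poisson r (x 0) * poisson r (x 1) * (Real.cos (2 * m * x 2) - Real.cos (m * x 2))

lemma analyticOnNhd_datum {r : ℝ} (h0 : 0 < r) (h1 : r < 1) (m : ℕ) :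
    AnalyticOnNhd ℝ (datum r m) Set.univ := by
  intro x _
  have hproj : ∀ i : Fin 3, AnalyticAt ℝ (fun y : Space => y i) x := fun i =>
    (ContinuousLinearMap.proj (R := ℝ) (φ := fun _ : Fin 3 => ℝ) i).analyticAt x
  have hp : ∀ i : Fin 3, AnalyticAt ℝ (fun y : Space => poisson r (y i)) x := fun i => by
    have hc : AnalyticAt ℝ (fun y : Space => Real.cos (y i)) x :=
      AnalyticAt.fun_comp (f := fun y : Space => y i) Real.analyticAt_cos (hproj i)
    exact analyticAt_const.div
      ((analyticAt_const.sub (analyticAt_const.mul hc)).add analyticAt_const)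
      (poisson_denom_pos h0 h1 (x i)).ne'
  have hc : ∀ c : ℝ, AnalyticAt ℝ (fun y : Space => Real.cos (c * y 2)) x := fun c =>
    AnalyticAt.fun_comp (f := fun y : Space => c * y 2) Real.analyticAt_cos
      (analyticAt_const.mul (hproj 2))
  exact ((hp 0).mul (hp 1)).mul ((hc (2 * m)).sub (hc m))

lemma isPeriodic_datum (r : ℝ) (m : ℕ) : IsPeriodic (datum r m) := by
  have hp : ∀ t, poisson r (t + 2 * Real.pi) = poisson r t := fun t => by simp [poisson]
  have hc : ∀ (k : ℕ) (t : ℝ), Real.cos (k * (t + 2 * Real.pi)) = Real.cos (k * t) := fun k t => by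
    rw [mul_add, Real.cos_add_nat_mul_two_pi]
  have hc2 := hc (2 * m)
  push_cast at hc2
  intro x i
  fin_cases i <;> simp [datum, hp, hc, hc2]

lemma hasZeroVerticalMean_datum (r : ℝ) {m : ℕ} (hm : 0 < m) :
    HasZeroVerticalMean (datum r m) := by
  have hc : ∀ k : ℕ, 0 < k → ∫ z in (0 : ℝ)..(2 * Real.pi), Real.cos (k * z) = 0 := by
    intro k hk
    have hk' : (k : ℝ) ≠ 0 := by positivity
    rw [intervalIntegral.integral_comp_mul_left _ hk', integral_cos, mul_zero, Real.sin_zero]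
    have := Real.sin_nat_mul_pi (2 * k)
    rw [show (k : ℝ) * (2 * Real.pi) = ((2 * k : ℕ) : ℝ) * Real.pi by push_cast; ring, this]
    simp
  intro x
  have h2 := hc (2 * m) (by omega)
  push_cast at h2
  simp only [datum, Function.update_self, ne_eq, Fin.reduceEq, not_false_eq_true,
    Function.update_of_ne]
  rw [intervalIntegral.integral_const_mul, intervalIntegral.integral_sub
    (Continuous.intervalIntegrable (by fun_prop) _ _)
    (Continuous.intervalIntegrable (by fun_prop) _ _), h2, hc m hm]
  simp

lemma circleCoef_cos_sub_cos (m : ℕ) (n : ℤ) :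
    circleCoef (fun x => ((Real.cos (2 * m * x) - Real.cos (m * x) : ℝ) : ℂ)) n =
      1 / 2 * (((if n = 2 * m then 1 else 0) + (if n = -(2 * m) then 1 else 0)) -
        ((if n = m then 1 else 0) + (if n = -m then 1 else 0))) := by
  have hδ : ∀ q : ℤ, Summable fun n : ℤ => if n = q then (1 : ℂ) else 0 := fun q =>
    (hasSum_ite_eq q 1).summable
  refine circleCoef_of_hasSum (c := fun n => 1 / 2 * (((if n = 2 * m then 1 else 0) +
    (if n = -(2 * m) then 1 else 0)) - ((if n = m then 1 else 0) + (if n = -m then 1 else 0))))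
    ((((hδ _).add (hδ _)).sub ((hδ _).add (hδ _))).mul_left (1 / 2)).norm (fun x => ?_) n
  have hE : ∀ q : ℤ, HasSum (fun n : ℤ => (if n = q then (1 : ℂ) else 0) *
      Complex.exp (Complex.I * (n * x))) (Complex.exp (Complex.I * (q * x))) := fun q => by
    refine (hasSum_ite_eq q (Complex.exp (Complex.I * (q * x)))).congr_fun fun n => ?_
    split_ifs with h <;> simp [h]
  have := (((hE (2 * m)).add (hE (-(2 * m)))).sub ((hE m).add (hE (-m)))).mul_left (1 / 2)
  have hval : ((Real.cos (2 * m * x) - Real.cos (m * x) : ℝ) : ℂ) = 1 / 2 *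
      ((Complex.exp (Complex.I * ((2 * m : ℤ) * x)) +
        Complex.exp (Complex.I * ((-(2 * m) : ℤ) * x))) -
      (Complex.exp (Complex.I * ((m : ℤ) * x)) + Complex.exp (Complex.I * ((-m : ℤ) * x)))) := by
    rw [Complex.ofReal_sub, Complex.ofReal_cos, Complex.ofReal_cos]
    simp only [Complex.cos]
    push_cast
    ring_nf
  rw [hval]
  exact this.congr_fun fun n => by ring

/-- On the parabola the horizontal factors contribute `r ^ (n² + n)`; the vertical factor is
`-1/2` at `j = 1`, `1/2` at `j = 2` and `0` otherwise. -/
lemma fourierCoef_datum_mode {r : ℝ} (h0 : 0 < r) (h1 : r < 1) (n : ℕ) {m : ℕ} (hm : 0 < m)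
    (j : ℕ) :
    (-1) ^ j * (fourierCoef (fun x => (datum r m x : ℂ)) (mode n m j)).re =
      if j = 1 ∨ j = 2 then r ^ (n ^ 2 + n) / 2 else 0 := by
  have hprod : (fun x : Space => (datum r m x : ℂ)) = fun x => ∏ i : Fin 3,
      (![fun y => (poisson r y : ℂ), fun y => (poisson r y : ℂ),
        fun y => ((Real.cos (2 * m * y) - Real.cos (m * y) : ℝ) : ℂ)] : Fin 3 → ℝ → ℂ) i (x i) := by
    ext x
    rw [Fin.prod_univ_three, datum, Complex.ofReal_mul, Complex.ofReal_mul]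
    rfl
  rw [hprod, fourierCoef_prod, Fin.prod_univ_three]
  have hc : circleCoef (fun y => ((Real.cos (2 * m * y) - Real.cos (m * y) : ℝ) : ℂ)) (j * m) =
      (((if j = 2 then 1 else 0) - (if j = 1 then 1 else 0)) / 2 : ℝ) := by
    rw [circleCoef_cos_sub_cos]
    have e1 : (j : ℤ) * m = 2 * m ↔ j = 2 := by
      rw [mul_eq_mul_right_iff]; omega
    have e2 : (j : ℤ) * m = m ↔ j = 1 := by
      rw [mul_eq_right₀ (by omega)]; omega
    have hjm : (0 : ℤ) ≤ j * m := by positivity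
    have e3 : ¬ (j : ℤ) * m = -(2 * m) := by omega
    have e4 : ¬ (j : ℤ) * m = -m := by omega
    simp only [e1, e2, e3, e4, if_false, add_zero]
    split_ifs <;> push_cast <;> ring
  simp only [mode, Matrix.cons_val_zero, Matrix.cons_val_one, Matrix.cons_val, hc,
    circleCoef_poisson h0 h1, ← Complex.ofReal_mul, Complex.ofReal_re, Int.natAbs_pow,
    Int.natAbs_natCast, ← pow_add]
  rcases eq_or_ne j 1 with rfl | hj1
  · simp; ring
  rcases eq_or_ne j 2 with rfl | hj2
  · simp; ring
  · simp [hj1, hj2]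

/-! ### Growth and nonexistence -/

lemma symbolRate_pos {Ω β η : ℝ} (hβ : 0 < β) (hη : 0 < η) (m : ℕ) : 0 < symbolRate Ω β η m := by
  rw [symbolRate]; positivity

/-- A solution starting from the datum has, at the frequency `(n², n, m)`, a Fourier coefficient that
grows at least like `exp (κ n² t)` with `κ` independent of `n`. -/
lemma IsSolution.coef_growth {Ω β η a T : ℝ} (hβ : 0 < β) (hη : 0 < η) (ha : 0 < a) {m : ℕ}
    (hm : 0 < m) (hT : 0 < T) {r : ℝ} (h0 : 0 < r) (h1 : r < 1) {θ : ℝ → Lp ℝ 2 cellMeasure}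
    (h : IsSolution Ω β η a m T (datum r m) θ) {B : ℝ} (hB : 0 ≤ B)
    (hbd : ∀ k, ∀ᵐ t, t ∈ Set.Ioo 0 T → ‖coefCLM k (θ t)‖ ≤ B) {n : ℕ} (hn : 0 < n) :
    ∀ᵐ t, t ∈ Set.Ioo 0 T →
      r ^ (n ^ 2 + n) / 2 * Real.exp (a * m / 2 * symbolRate Ω β η m * (n : ℝ) ^ 2 * t) ≤ B := by
  have hc : 0 ≤ a * m / 2 := by positivity
  have hint : ∀ k, IntegrableOn (fun t => coefCLM k (θ t)) (Set.Ioo 0 T) := fun k =>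
    ((coefCLM k).comp_memLp' h.1).integrable le_top
  -- the signs `(-1) ^ j` make the coupling nonnegative
  set z : ℕ → ℝ → ℝ := fun j t => (-1) ^ j * (coefCLM (mode n m j) (θ t)).re with hz
  set z₀ : ℕ → ℝ := fun j => (-1) ^ j * (fourierCoef (fun x => (datum r m x : ℂ)) (mode n m j)).re
    with hz₀
  set p : ℕ → ℝ := fun j => a * m / 2 * symbolM3 Ω β η (mode n m j) with hp
  have hz₀v : ∀ j, z₀ j = if j = 1 ∨ j = 2 then r ^ (n ^ 2 + n) / 2 else 0 :=
    fourierCoef_datum_mode h0 h1 n hm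
  have hε : 0 ≤ r ^ (n ^ 2 + n) / 2 := by positivity
  have hzint : ∀ j, IntegrableOn (z j) (Set.Ioo 0 T) := fun j => (hint _).re.const_mul _
  have hzabs : ∀ j t, |z j t| ≤ ‖coefCLM (mode n m j) (θ t)‖ := fun j t => by
    simp only [hz, abs_mul, abs_pow, abs_neg, abs_one, one_pow, one_mul]
    exact Complex.abs_re_le_norm _
  have hzbd : ∀ j, ∀ᵐ t, t ∈ Set.Ioo 0 T → |z j t| ≤ B := fun j => by
    filter_upwards [hbd (mode n m j)] with t ht hmem
    exact (hzabs j t).trans (ht hmem)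
  have hode : ∀ j, ∀ᵐ t, t ∈ Set.Ioo 0 T →
      z (j + 1) t = z₀ (j + 1) + ∫ s in (0 : ℝ)..t, (p j * z j s + p (j + 2) * z (j + 2) s) := by
    intro j
    have hre : ∀ k, IntegrableOn (fun t => (coefCLM k (θ t)).re) (Set.Ioo 0 T) := fun k =>
      (hint k).re
    have hw := ae_eq_primitive_of_weak hT (hre (mode n m (j + 1)))
      (g := fun t => -(p j * (coefCLM (mode n m j) (θ t)).re +
        p (j + 2) * (coefCLM (mode n m (j + 2)) (θ t)).re))
      (((hre _).const_mul _).add ((hre _).const_mul _)).neg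
      (y₀ := (fourierCoef (fun x => (datum r m x : ℂ)) (mode n m (j + 1))).re)
      (fun χ hχ hχ0 => by
        have := h.weak_mode hT hint (mode n m (j + 1)) χ hχ hχ0
        rwa [mode_sub, mode_add] at this)
    filter_upwards [hw] with t ht hmem
    simp only [hz, hz₀]
    rw [ht hmem, mul_add, ← intervalIntegral.integral_const_mul]
    congr 2
    ext s
    ring
  have hγ1 : ∀ j, 0 < j → j ≤ 2 → a * m / 2 * symbolRate Ω β η m * (n : ℝ) ^ 2 ≤ p j :=
    fun j hj hj2 => by
      rw [mul_assoc]
      exact mul_le_mul_of_nonneg_left (le_symbolM3_mode hβ hη hn hm hj hj2) hc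
  have hgrow := chain_growth (ε := r ^ (n ^ 2 + n) / 2) (A := r ^ (n ^ 2 + n) / 2) hT hB hε
    (mul_nonneg (mul_nonneg hc (symbolRate_pos hβ hη m).le) (sq_nonneg _))
    (p := p) (by simp [hp, symbolM3_mode_zero])
    (fun j => mul_nonneg hc (symbolM3_mode_nonneg hη n m j))
    (fun j => mul_le_mul_of_nonneg_left (symbolM3_mode_le hβ hη hn m j) hc)
    (hγ1 1 one_pos one_le_two) (hγ1 2 two_pos le_rfl) (z₀ := z₀)
    (fun j => by rw [hz₀v]; split_ifs <;> simp [hε])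
    (fun j => by rw [hz₀v]; split_ifs <;> simp [hε])
    (by rw [hz₀v]; simp) (by rw [hz₀v]; simp) hzint hzbd hode
  filter_upwards [hgrow, hzbd 1] with t h1 h2 hmem
  exact (h1 hmem).trans ((le_abs_self _).trans (h2 hmem))

/-- If the Fourier coefficients of the datum decay slowly compared to the growth over the time `T`,
there is no solution at all in `L^∞(0,T;L²)`. -/
lemma not_isSolution_datum {Ω β η a T : ℝ} (hβ : 0 < β) (hη : 0 < η) (ha : 0 < a) {m : ℕ}
    (hm : 0 < m) (hT : 0 < T) (θ : ℝ → Lp ℝ 2 cellMeasure) :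
    ¬ IsSolution Ω β η a m T
      (datum (Real.exp (-(a * m / 2 * symbolRate Ω β η m * T / 8))) m) θ := by
  intro h
  set κ := a * m / 2 * symbolRate Ω β η m with hκ
  have hκ0 : 0 < κ := by
    have := symbolRate_pos (Ω := Ω) hβ hη m
    positivity
  set N := (eLpNorm θ ∞ (volume.restrict (Set.Ioo 0 T))).toReal with hN
  have hθ : ∀ᵐ t, t ∈ Set.Ioo 0 T → ‖θ t‖ ≤ N := by
    rw [← ae_restrict_iff' measurableSet_Ioo]
    filter_upwards [ae_le_eLpNormEssSup (f := θ) (μ := volume.restrict (Set.Ioo 0 T))] with t ht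
    rw [← eLpNorm_exponent_top] at ht
    have := ENNReal.toReal_mono h.1.eLpNorm_ne_top ht
    rwa [toReal_enorm] at this
  have hD : 0 ≤ coefBound := by rw [coefBound]; positivity
  have hbd : ∀ k, ∀ᵐ t, t ∈ Set.Ioo 0 T → ‖coefCLM k (θ t)‖ ≤ coefBound * N := fun k => by
    filter_upwards [hθ] with t ht hmem
    exact (norm_fourierCoef_le (θ t) k).trans (mul_le_mul_of_nonneg_left (ht hmem) hD)
  have hB : 0 ≤ coefBound * N := mul_nonneg hD ENNReal.toReal_nonneg
  have hr1 : Real.exp (-(κ * T / 8)) < 1 := by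
    rw [Real.exp_lt_one_iff, neg_lt_zero]; positivity
  -- evaluation at a time in the second half of the interval
  have hexp : ∀ n : ℕ, 0 < n → 1 / 2 * Real.exp (κ * T / 4 * (n : ℝ) ^ 2) ≤ coefBound * N := by
    intro n hn
    have hg := h.coef_growth hβ hη ha hm hT (Real.exp_pos _) hr1 hB hbd hn
    -- `r ^ (n² + n) ≥ exp (-κ T n² / 4)` and the growth factor exceeds `exp (κ T n² / 2)`
    have hpos : volume (Set.Ioo (T / 2) T) ≠ 0 := by
      rw [Real.volume_Ioo]; simp; linarith
    obtain ⟨t, ht, hgt⟩ : ∃ t ∈ Set.Ioo (T / 2) T, t ∈ Set.Ioo 0 T → _ :=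
      (frequently_ae_mem_iff.2 hpos).and_eventually hg |>.exists
    refine le_trans ?_ (hgt ⟨by linarith [ht.1], ht.2⟩)
    have hsplit : ∀ A B : ℝ, Real.exp A / 2 * Real.exp B = 1 / 2 * Real.exp (A + B) := fun A B => by
      rw [Real.exp_add]; ring
    rw [← hκ, ← Real.exp_nat_mul, hsplit]
    gcongr
    have hn1 : (1 : ℝ) ≤ n := by exact_mod_cast hn
    have h2 : (n : ℝ) ≤ (n : ℝ) ^ 2 := by nlinarith
    push_cast
    have h3 : κ * T / 8 * (n : ℝ) ≤ κ * T / 8 * (n : ℝ) ^ 2 :=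
      mul_le_mul_of_nonneg_left h2 (by positivity)
    have h4 : κ * (n : ℝ) ^ 2 * (T / 2) ≤ κ * (n : ℝ) ^ 2 * t :=
      mul_le_mul_of_nonneg_left ht.1.le (by positivity)
    linarith
  have hlim : Filter.Tendsto (fun n : ℕ => κ * T / 4 * (n : ℝ) ^ 2) Filter.atTop Filter.atTop :=
    ((Filter.tendsto_pow_atTop (two_ne_zero)).comp tendsto_natCast_atTop_atTop).const_mul_atTop
      (by positivity)
  obtain ⟨n, hn, hlarge⟩ := ((Filter.eventually_gt_atTop 0).and
    (hlim.eventually_gt_atTop (2 * (coefBound * N)))).exists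
  have := hexp n hn
  have := Real.add_one_le_exp (κ * T / 4 * (n : ℝ) ^ 2)
  linarith

end MG
end

theorem theorem2p3 (Ω β η : ℝ) (hΩ : 0 < Ω) (hβ : 0 < β) (hη : 0 < η)
    (a : ℝ) (ha : 0 < a) (m : ℕ) (hm : 0 < m) (T K : ℝ) (hT : 0 < T) (hK : 0 < K) :
    ∃ θ₀ : MG.Space → ℝ,
      AnalyticOnNhd ℝ θ₀ Set.univ ∧ MG.IsPeriodic θ₀ ∧ MG.HasZeroVerticalMean θ₀ ∧
      ∀ (s : ℝ) (p : ℝ≥0∞), 1 ≤ p → MG.EmbedsInL2 s p →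
        ¬ ∃ θ : ℝ → Lp ℝ 2 MG.cellMeasure,
          MG.IsSolution Ω β η a m T θ₀ θ ∧
          eLpNorm θ ∞ (volume.restrict (Set.Ioo 0 T)) ≤
            ENNReal.ofReal K * MG.sobolevNorm s p (fun x => (θ₀ x : ℂ)) := by
  have hr : Real.exp (-(a * m / 2 * MG.symbolRate Ω β η m * T / 8)) < 1 := by
    have := MG.symbolRate_pos (Ω := Ω) hβ hη m
    rw [Real.exp_lt_one_iff, neg_lt_zero]; positivity
  refine ⟨MG.datum (Real.exp (-(a * m / 2 * MG.symbolRate Ω β η m * T / 8))) m,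
    MG.analyticOnNhd_datum (Real.exp_pos _) hr m, MG.isPeriodic_datum _ m,
    MG.hasZeroVerticalMean_datum _ hm, ?_⟩
  rintro s p - - ⟨θ, hθ, -⟩
  exact MG.not_isSolution_datum hβ hη ha hm hT θ hθ
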